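/- Let $p,q\ge 1$ be relatively prime integers and let $G=\langle a,b\mid a^p=b^q\rangle$ be the group of the $(p,q)$-torus knot. Put $\tau=a^p=b^q$ (a central element) and $\omega=b^na^m$, where $m,n\in\mathbb{Z}$ satisfy $mq+np=1$ ($\omega$ represents a meridian). Let $Y$ be a CAT(0) $G$-space, i.e. a non-empty proper CAT(0) space on which $G$ acts properly discontinuously and cocompactly by isometries. For an isometry $h$ of $Y$, an axis of $h$ is a geodesic line on which $h$ restricts to a non-trivial translation, $h^\infty\in\partial Y$ is the endpoint of an axis of $h$ in the direction of translation, and $\operatorname{Min}h$ is the set of points where $y\mapsto d(y,hy)$ attains its minimum. Then: 1. The points $\omega^\infty$ and $\tau^\infty$ of $\partial Y$ exist and are unique (that is, $\omega$ and $\tau$ have axes, and the endpoint does not depend on the axis), and $$\angle_{Tits}(\omega^\infty,\tau^\infty)\neq\frac{\pi}{2},$$ where $\angle_{Tits}(\xi,\eta)$ is the supremum over $y\in Y$ of the Alexandrov angle at $y$ between the geodesic rays from $y$ to $\xi$ and to $\eta$. 2. There is a metric space $Z$ and an isometry of $\operatorname{Min}\tau$ onto the $\ell^2$-product $Z\times\mathbb{R}$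 under which the axes of $\tau$ are exactly the lines $\{z\}\times\mathbb{R}$. For every such splitting, $\operatorname{Min}\tau$ is $G$-invariant and every $g\in G$ acts on the $\mathbb{R}$-coordinate of $\operatorname{Min}\tau$ as a translation by some number $\lambda(g)$; moreover $$\lambda(\omega)=\frac{\lambda(\tau)}{pq}\neq 0.$$ -/

import Mathlib

open Set Filter Topology
open scoped NNReal Pointwise

universe u v

/-! ### Torus knot groups -/

/-- The single relator `a ^ p * (b ^ q)⁻¹`; `a` is the generator `0` and `b` is the generator `1`. -/
def torusKnotRels (p q : ℕ) : Set (FreeGroup (Fin 2)) :=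
  {FreeGroup.of 0 ^ p * (FreeGroup.of 1 ^ q)⁻¹}

/-- The torus knot group `⟨a, b | a ^ p = b ^ q⟩`. -/
abbrev TorusKnotGroup (p q : ℕ) : Type := PresentedGroup (torusKnotRels p q)

namespace TorusKnotGroup

/-- The generator `a`. -/
def a (p q : ℕ) : TorusKnotGroup p q := PresentedGroup.of 0

/-- The generator `b`. -/
def b (p q : ℕ) : TorusKnotGroup p q := PresentedGroup.of 1

/-- The central element `τ = a ^ p = b ^ q`. -/
def tau (p q : ℕ) : TorusKnotGroup p q := a p q ^ p

theorem tau_eq (p q : ℕ) : tau p q = b p q ^ q := by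
  have h : (PresentedGroup.mk (torusKnotRels p q)
      (FreeGroup.of 0 ^ p * (FreeGroup.of 1 ^ q)⁻¹)) = 1 :=
    PresentedGroup.one_of_mem (rfl : _ ∈ torusKnotRels p q)
  rw [map_mul, map_inv, map_pow, map_pow, mul_inv_eq_one] at h
  exact h

/-- The element `b ^ n * a ^ m`. When `m * q + n * p = 1` it is the class of a meridian,
and it does not depend on the choice of the solution `(m, n)`. -/
def omega (p q : ℕ) (m n : ℤ) : TorusKnotGroup p q := b p q ^ n * a p q ^ m

end TorusKnotGroup

/-! ### CAT(0) spaces and geometric actions -/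

/-- `c` restricted to `[0, l]` is a geodesic from `x` to `y`, parametrized by arc length. -/
structure IsGeodesicPath {X : Type*} [MetricSpace X] (c : ℝ → X) (l : ℝ) (x y : X) : Prop where
  nonneg : 0 ≤ l
  source : c 0 = x
  target : c l = y
  dist_eq : ∀ s ∈ Icc 0 l, ∀ t ∈ Icc 0 l, dist (c s) (c t) = |s - t|

/-- A proper CAT(0) space. The comparison inequality is stated for a point `c s` on the side
`[x, y]` and a point `c' t` on the side `[x, z]` of a geodesic triangle, with comparison points
`p'` and `q'` in a comparison triangle `x' y' z'` in the Euclidean plane; the other pairs of sides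
are covered by relabelling the vertices. -/
structure IsCAT0 (X : Type*) [MetricSpace X] : Prop where
  proper : ProperSpace X
  geodesic : ∀ x y : X, ∃ (c : ℝ → X) (l : ℝ), IsGeodesicPath c l x y
  comparison : ∀ (x y z : X) (c c' : ℝ → X) (l l' : ℝ),
    IsGeodesicPath c l x y → IsGeodesicPath c' l' x z →
    ∀ s ∈ Icc 0 l, ∀ t ∈ Icc 0 l', ∀ x' y' z' p' q' : EuclideanSpace ℝ (Fin 2),
      dist x' y' = dist x y → dist x' z' = dist x z → dist y' z' = dist y z →
      p' ∈ segment ℝ x' y' → dist x' p' = dist x (c s) →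
      q' ∈ segment ℝ x' z' → dist x' q' = dist x (c' t) →
      dist (c s) (c' t) ≤ dist p' q'

/-- The action of `G` on `X` is geometric: properly discontinuous, cocompact, by isometries. -/
structure IsGeometricAction (G X : Type*) [Group G] [MetricSpace X] [MulAction G X] : Prop where
  isometric : IsIsometricSMul G X
  properlyDiscontinuous : ProperlyDiscontinuousSMul G X
  cocompact : ∃ K : Set X, IsCompact K ∧ ⋃ g : G, g • K = univ

/-! ### The boundary, angles -/

/-- Geodesic rays, parametrized by arc length. -/
def GeodesicRay (X : Type*) [MetricSpace X] : Type _ := {c : ℝ≥0 → X // Isometry c}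

instance {X : Type*} [MetricSpace X] : CoeFun (GeodesicRay X) (fun _ => ℝ≥0 → X) :=
  ⟨Subtype.val⟩

/-- Two rays are asymptotic if they stay at bounded distance. -/
instance GeodesicRay.setoid (X : Type*) [MetricSpace X] : Setoid (GeodesicRay X) where
  r c c' := ∃ K : ℝ, ∀ t : ℝ≥0, dist (c t) (c' t) ≤ K
  iseqv :=
    { refl := fun c => ⟨0, fun t => by simp⟩
      symm := fun ⟨K, hK⟩ => ⟨K, fun t => by rw [dist_comm]; exact hK t⟩
      trans := fun ⟨K, hK⟩ ⟨L, hL⟩ =>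
        ⟨K + L, fun t => (dist_triangle _ _ _).trans (add_le_add (hK t) (hL t))⟩ }

/-- The ideal boundary `∂X` (as a set): classes of asymptotic geodesic rays. -/
def IdealBoundary (X : Type*) [MetricSpace X] : Type _ := Quotient (GeodesicRay.setoid X)

/-- The endpoint `c(∞)` of a geodesic ray. -/
def GeodesicRay.endpoint {X : Type*} [MetricSpace X] (c : GeodesicRay X) : IdealBoundary X :=
  Quotient.mk (GeodesicRay.setoid X) c

/-- The angle at `p` in a Euclidean comparison triangle for `p, x, y` (for `x ≠ p ≠ y`). -/
noncomputable def comparisonAngle {X : Type*} [MetricSpace X] (p x y : X) : ℝ :=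
  Real.arccos ((dist p x ^ 2 + dist p y ^ 2 - dist x y ^ 2) / (2 * dist p x * dist p y))

/-- The Alexandrov angle between two geodesic rays with the same initial point: the upper limit
of the comparison angles at `c 0` for `c s` and `c' t`, as `s, t → 0` with `s, t > 0`. -/
noncomputable def alexandrovAngle {X : Type*} [MetricSpace X] (c c' : GeodesicRay X) : ℝ :=
  limsup (fun u : ℝ≥0 × ℝ≥0 => comparisonAngle (c 0) (c u.1) (c' u.2))
    (𝓝[>] (0 : ℝ≥0) ×ˢ 𝓝[>] (0 : ℝ≥0))

/-- The Tits angle: the supremum, over all points `x`, of the Alexandrov angle at `x` between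
the geodesic rays issuing from `x` with endpoints `ξ` and `η`. -/
noncomputable def titsAngle {X : Type*} [MetricSpace X] (ξ η : IdealBoundary X) : ℝ :=
  sSup {θ : ℝ | ∃ c c' : GeodesicRay X,
    c 0 = c' 0 ∧ c.endpoint = ξ ∧ c'.endpoint = η ∧ θ = alexandrovAngle c c'}

/-! ### Axes and minimal sets of isometries -/

/-- `h` translates the geodesic line `c` by the distance `l`, in the direction of `c` if
`0 < l` and in the opposite direction if `l < 0`. -/
def TranslatesLine {X : Type*} [MetricSpace X] (h : X → X) (c : ℝ → X) (l : ℝ) : Prop :=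
  Isometry c ∧ ∀ t : ℝ, h (c t) = c (t + l)

/-- `L` is an axis of `h`: a geodesic line on which `h` restricts to a non-trivial translation. -/
def IsAxis {X : Type*} [MetricSpace X] (h : X → X) (L : Set X) : Prop :=
  ∃ (c : ℝ → X) (l : ℝ), TranslatesLine h c l ∧ l ≠ 0 ∧ range c = L

/-- The positive half of a geodesic line. -/
def GeodesicRay.ofLine {X : Type*} [MetricSpace X] (c : ℝ → X) (hc : Isometry c) :
    GeodesicRay X :=
  ⟨fun t => c t, hc.comp isometry_subtype_coe⟩

/-- `ξ = h^∞`: the endpoint of an axis of `h` in the direction in which `h` translates. -/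
def IsForwardEndpoint {X : Type*} [MetricSpace X] (h : X → X) (ξ : IdealBoundary X) : Prop :=
  ∃ (c : ℝ → X) (l : ℝ) (hc : TranslatesLine h c l),
    0 < l ∧ ξ = (GeodesicRay.ofLine c hc.1).endpoint

/-- The set where the displacement `x ↦ d(x, h x)` attains its minimum. -/
def minSet {X : Type*} [MetricSpace X] (h : X → X) : Set X :=
  {x | ∀ y, dist x (h x) ≤ dist y (h y)}

/-- `e` is a splitting of `Min h` as an `ℓ²` product `Z × ℝ` in which the axes of `h` are exactly
the lines `{z} × ℝ`. -/
def IsMinSplitting {X Z : Type*} [MetricSpace X] [MetricSpace Z] (h : X → X)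
    (e : minSet h ≃ᵢ WithLp 2 (Z × ℝ)) : Prop :=
  ∀ L : Set X, IsAxis h L ↔
    ∃ z : Z, L = range (fun t : ℝ => (e.symm (WithLp.toLp 2 (z, t)) : X))

/-! ### The CAT(0) inequality -/

/-! Since `τ` is central, every `g` permutes the axes of `τ`, which are parallel and fill `Min τ = Z
× ℝ`. It respects their direction, so it shifts the `ℝ`-coordinate by a number `λ(g)`, and `λ` is a
homomorphism (`exists_hom`). From `λ(τ) = p λ(a) = q λ(b)` follows `λ(ω) = λ(τ) (m / p + n / q) =
λ(τ) / (p q)`, which has the sign of `λ(τ) ≠ 0`.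

For the angle, no axis of `ω` inside `Min τ` is needed. For `x` on an axis of `τ`, Pythagoras in `Z
× ℝ` gives the distance from `ω ^ k x` to `τ ^ k x`, with cross term `-2 k² λ(ω) λ(τ)`. Up to
bounded error these points lie at distances `k l`, `k l'` along rays to `ω^∞`, `τ^∞` from any base
point, so the comparison cosines tend to `λ(ω) λ(τ) / (l l') > 0`. Alexandrov angles are at most
comparison angles, so the Tits angle is less than `π / 2` (`titsAngle_lt_pi_div_two`).

The general theory rests on the Bruhat–Tits inequality: it yields axes (`exists_translatesLine`),
flat strips (`exists_isFlatStrip`) and the splitting (`exists_isMinSplitting`). The map `toInt` to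
`ℤ` shows that `ω` and `τ` have infinite order. -/

theorem exists_euclidean_triangle {l l' d : ℝ} (hl : 0 < l) (hl' : 0 ≤ l') (hd : d ≤ l + l')
    (hd' : |l - l'| ≤ d) :
    ∃ y z : EuclideanSpace ℝ (Fin 2), ‖y‖ = l ∧ ‖z‖ = l' ∧ dist y z = d := by
  have hd0 : 0 ≤ d := (abs_nonneg _).trans hd'
  have h1 : (l - l') ^ 2 ≤ d ^ 2 := by
    rw [← sq_abs (l - l')]; exact pow_le_pow_left₀ (abs_nonneg _) hd' 2
  have h2 : d ^ 2 ≤ (l + l') ^ 2 := pow_le_pow_left₀ hd0 hd 2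
  -- With the vertices `0` and `(l, 0)` fixed, the law of cosines forces the abscissa `u` of the
  -- third; `|u| ≤ l'` is the triangle inequality.
  obtain ⟨u, hu⟩ : ∃ u : ℝ, 2 * l * u = l ^ 2 + l' ^ 2 - d ^ 2 :=
    ⟨(l ^ 2 + l' ^ 2 - d ^ 2) / (2 * l), by field_simp⟩
  have hu1 : u ≤ l' := by
    by_contra! h
    nlinarith [mul_lt_mul_of_pos_left h hl]
  have hu2 : -l' ≤ u := by
    by_contra! h
    nlinarith [mul_lt_mul_of_pos_left h hl]
  have hv : 0 ≤ l' ^ 2 - u ^ 2 := by nlinarith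
  refine ⟨!₂[l, 0], !₂[u, √(l' ^ 2 - u ^ 2)], ?_, ?_, ?_⟩
  · rw [EuclideanSpace.norm_eq]
    simp [Fin.sum_univ_two, Real.sqrt_sq hl.le]
  · rw [EuclideanSpace.norm_eq]
    simp [Fin.sum_univ_two, Real.sq_sqrt hv, Real.sqrt_sq hl']
  · rw [EuclideanSpace.dist_eq]
    simp only [Fin.sum_univ_two, Real.dist_eq, sq_abs]
    have : (l - u) ^ 2 + (0 - √(l' ^ 2 - u ^ 2)) ^ 2 = d ^ 2 := by
      rw [zero_sub, neg_sq, Real.sq_sqrt hv]; linarith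
    exact (congrArg Real.sqrt this).trans (Real.sqrt_sq hd0)

section Metric

variable {X : Type*} [MetricSpace X]

theorem IsGeodesicPath.dist_source {c : ℝ → X} {l : ℝ} {x y : X} (h : IsGeodesicPath c l x y)
    {s : ℝ} (hs : s ∈ Icc 0 l) : dist x (c s) = s := by
  have := h.dist_eq 0 ⟨le_rfl, h.nonneg⟩ s hs
  rwa [h.source, zero_sub, abs_neg, abs_of_nonneg hs.1] at this

theorem IsGeodesicPath.length_eq {c : ℝ → X} {l : ℝ} {x y : X} (h : IsGeodesicPath c l x y) :
    l = dist x y := by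
  rw [← h.dist_source ⟨h.nonneg, le_rfl⟩, h.target]

/-- The CAT(0) inequality for points on two sides of a triangle, expressed by distances. -/
theorem IsCAT0.comparison_sq (hX : IsCAT0 X) {x y z : X} {c c' : ℝ → X} {l l' : ℝ}
    (hc : IsGeodesicPath c l x y) (hc' : IsGeodesicPath c' l' x z) (hl : 0 < l) (hl' : 0 < l')
    {s t : ℝ} (hs : s ∈ Icc 0 l) (ht : t ∈ Icc 0 l') :
    dist (c s) (c' t) ^ 2 ≤
      s ^ 2 + t ^ 2 - s * t / (l * l') * (l ^ 2 + l' ^ 2 - dist y z ^ 2) := by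
  have hxy := hc.length_eq
  have hxz := hc'.length_eq
  obtain ⟨y', z', hy', hz', hyz'⟩ := exists_euclidean_triangle (d := dist y z) hl hl'.le
    (by rw [hxy, hxz, dist_comm x y]; exact dist_triangle _ _ _)
    (by rw [hxy, hxz, dist_comm x y, dist_comm x z]; exact abs_dist_sub_le _ _ _)
  have key := hX.comparison x y z c c' l l' hc hc' s hs t ht 0 y' z' ((s / l) • y')
    ((t / l') • z') (by simp [hy', hxy]) (by simp [hz', hxz]) hyz'
    ⟨1 - s / l, s / l, sub_nonneg.2 (div_le_one_of_le₀ hs.2 hl.le), div_nonneg hs.1 hl.le,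
      by ring, by simp⟩
    (by rw [hc.dist_source hs, dist_zero_left, norm_smul, hy', Real.norm_of_nonneg
          (div_nonneg hs.1 hl.le)]; field_simp)
    ⟨1 - t / l', t / l', sub_nonneg.2 (div_le_one_of_le₀ ht.2 hl'.le), div_nonneg ht.1 hl'.le,
      by ring, by simp⟩
    (by rw [hc'.dist_source ht, dist_zero_left, norm_smul, hz', Real.norm_of_nonneg
          (div_nonneg ht.1 hl'.le)]; field_simp)
  have hin : dist y z ^ 2 = l ^ 2 - 2 * inner ℝ y' z' + l' ^ 2 := by
    rw [← hyz', dist_eq_norm, norm_sub_sq_real, hy', hz']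
  calc dist (c s) (c' t) ^ 2 ≤ dist ((s / l) • y') ((t / l') • z') ^ 2 :=
        pow_le_pow_left₀ dist_nonneg key 2
    _ = _ := by
        rw [dist_eq_norm, norm_sub_sq_real, norm_smul, norm_smul, hy', hz', hin,
          real_inner_smul_left, real_inner_smul_right, Real.norm_of_nonneg
          (div_nonneg hs.1 hl.le), Real.norm_of_nonneg (div_nonneg ht.1 hl'.le)]
        field_simp
        ring

/-! ### Midpoints -/

/-- `m` is a midpoint of `x` and `y`. -/
def IsMidpoint (m x y : X) : Prop := dist x m = dist x y / 2 ∧ dist m y = dist x y / 2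

theorem IsMidpoint.symm {m x y : X} (h : IsMidpoint m x y) : IsMidpoint m y x :=
  ⟨by rw [dist_comm, h.2, dist_comm x y], by rw [dist_comm, h.1, dist_comm x y]⟩

theorem isMidpoint_of_isometry {c : ℝ → X} (hc : Isometry c) (t T : ℝ) :
    IsMidpoint (c t) (c (t - T)) (c (t + T)) := by
  constructor <;> simp only [hc.dist_eq, Real.dist_eq]
  · rw [show t - T - t = -T by ring, show t - T - (t + T) = -(2 * T) by ring, abs_neg, abs_neg,
      abs_mul, abs_two]; ring
  · rw [show t - (t + T) = -T by ring, show t - T - (t + T) = -(2 * T) by ring, abs_neg, abs_neg,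
      abs_mul, abs_two]; ring

theorem IsCAT0.exists_isMidpoint_and_dist_sq_le (hX : IsCAT0 X) (x y : X) :
    ∃ m, IsMidpoint m x y ∧
      ∀ p, dist p m ^ 2 ≤ (dist p x ^ 2 + dist p y ^ 2) / 2 - dist x y ^ 2 / 4 := by
  rcases eq_or_ne x y with rfl | hxy
  · exact ⟨x, by simp [IsMidpoint], fun p => by simp⟩
  obtain ⟨c, l, hc⟩ := hX.geodesic x y
  have hl := hc.length_eq
  have hl0 : 0 < l := hl ▸ dist_pos.2 hxy
  have hm : l / 2 ∈ Icc 0 l := ⟨by linarith, by linarith⟩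
  have hmid : IsMidpoint (c (l / 2)) x y := by
    refine ⟨by rw [hc.dist_source hm, hl], ?_⟩
    have := hc.dist_eq _ hm l ⟨hl0.le, le_rfl⟩
    rw [hc.target, show l / 2 - l = -(l / 2) by ring, abs_neg, abs_of_nonneg hm.1] at this
    rw [this, hl]
  refine ⟨c (l / 2), hmid, fun p => ?_⟩
  rcases eq_or_ne x p with rfl | hp
  · rw [hmid.1]; simp; linarith [sq_nonneg (dist x y)]
  obtain ⟨c', l', hc'⟩ := hX.geodesic x p
  have hl' := hc'.length_eq
  have hl0' : 0 < l' := hl' ▸ dist_pos.2 hp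
  have := hX.comparison_sq hc hc' hl0 hl0' hm (t := l') ⟨hl0'.le, le_rfl⟩
  rw [hc'.target] at this
  rw [dist_comm p, dist_comm p x, dist_comm p y, ← hl', ← hl]
  refine this.trans (le_of_eq ?_)
  field_simp
  ring

theorem IsCAT0.exists_isMidpoint (hX : IsCAT0 X) (x y : X) : ∃ m, IsMidpoint m x y :=
  let ⟨m, hm, _⟩ := hX.exists_isMidpoint_and_dist_sq_le x y
  ⟨m, hm⟩

/-- The Bruhat–Tits inequality. -/
theorem IsCAT0.dist_sq_le_of_isMidpoint (hX : IsCAT0 X) {m x y : X} (hm : IsMidpoint m x y)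
    (p : X) : dist p m ^ 2 ≤ (dist p x ^ 2 + dist p y ^ 2) / 2 - dist x y ^ 2 / 4 := by
  obtain ⟨m', hm', h⟩ := hX.exists_isMidpoint_and_dist_sq_le x y
  -- At `p = m` the right-hand side vanishes, so `m = m'`: midpoints are unique.
  have h0 := h m
  rw [dist_comm m x, hm.1, hm.2] at h0
  have : dist m m' = 0 := by
    have h1 : dist m m' ^ 2 ≤ 0 := by linarith
    exact pow_eq_zero_iff two_ne_zero |>.1 (le_antisymm h1 (sq_nonneg _))
  rw [dist_eq_zero.1 this]
  exact h p

/-- The sum of the squares of the diagonals is at most that of the sides. -/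
theorem IsCAT0.quadrilateral (hX : IsCAT0 X) (x y z w : X) :
    dist x z ^ 2 + dist y w ^ 2 ≤ dist x y ^ 2 + dist y z ^ 2 + dist z w ^ 2 + dist w x ^ 2 := by
  obtain ⟨m, hm⟩ := hX.exists_isMidpoint y w
  have h1 := hX.dist_sq_le_of_isMidpoint hm x
  have h2 := hX.dist_sq_le_of_isMidpoint hm z
  have h3 : dist x z ≤ dist x m + dist z m := by
    rw [dist_comm z m]; exact dist_triangle _ _ _
  have h4 : dist x z ^ 2 ≤ (dist x m + dist z m) ^ 2 := pow_le_pow_left₀ dist_nonneg h3 2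
  rw [dist_comm y z, dist_comm w x]
  nlinarith [sq_nonneg (dist x m - dist z m)]

/-- Bruhat–Tits is used twice: from `m` to the midpoint of `x z`, then from `z` to the midpoint of
`x y`. -/
theorem IsCAT0.dist_midpoint_le (hX : IsCAT0 X) {m m' x y z : X} (hm : IsMidpoint m x y)
    (hm' : IsMidpoint m' x z) : dist m m' ≤ dist y z / 2 := by
  have h1 := hX.dist_sq_le_of_isMidpoint hm' m
  have h2 := hX.dist_sq_le_of_isMidpoint hm z
  rw [dist_comm z m, dist_comm z x, dist_comm z y] at h2
  rw [dist_comm m x, hm.1] at h1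
  refine abs_le_of_sq_le_sq' ?_ (by positivity) |>.2
  nlinarith

/-- The diagonal from `x` to `y'` cuts the quadrilateral into two triangles. This is the convexity
of the distance between two geodesics. -/
theorem IsCAT0.dist_midpoint_midpoint_le (hX : IsCAT0 X) {m m' x y x' y' : X}
    (hm : IsMidpoint m x y) (hm' : IsMidpoint m' x' y') :
    dist m m' ≤ (dist x x' + dist y y') / 2 := by
  obtain ⟨o, ho⟩ := hX.exists_isMidpoint x y'
  have h1 := hX.dist_midpoint_le hm ho
  have h2 := hX.dist_midpoint_le ho.symm hm'.symm
  linarith [dist_triangle m o m']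

/-! ### Parallel lines -/

/-- A bounded midpoint-convex function on the line is constant. -/
theorem eq_of_bounded_of_midpoint_convex {f : ℝ → ℝ} {K : ℝ} (hK : ∀ t, |f t| ≤ K)
    (hf : ∀ t T, 2 * f t ≤ f (t - T) + f (t + T)) (s t : ℝ) : f s = f t := by
  -- By convexity, a positive increment over one step `T` never shrinks, so `f` would be unbounded
  -- along `s + n * T`.
  have step : ∀ s T, f (s + T) ≤ f s := by
    intro s T
    by_contra! h
    have h1 : ∀ n : ℕ, f (s + T) - f s ≤ f (s + (n + 1) * T) - f (s + n * T) := by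
      intro n
      induction n with
      | zero => simp
      | succ n ih =>
        have := hf (s + (n + 1) * T) T
        rw [show s + (n + 1) * T - T = s + n * T by ring,
          show s + (n + 1) * T + T = s + ((n : ℝ) + 1 + 1) * T by ring] at this
        push_cast
        linarith
    have h2 : ∀ n : ℕ, n * (f (s + T) - f s) ≤ f (s + n * T) - f s := by
      intro n
      induction n with
      | zero => simp
      | succ n ih =>
        have := h1 n
        push_cast
        linarith
    obtain ⟨n, hn⟩ := exists_nat_gt (2 * K / (f (s + T) - f s))
    rw [div_lt_iff₀ (sub_pos.2 h)] at hn
    have := h2 n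
    have h3 := abs_le.1 (hK (s + n * T))
    have h4 := abs_le.1 (hK s)
    linarith
  apply le_antisymm
  · simpa using step t (s - t)
  · simpa using step s (t - s)

/-- Jensen's equation with `g 0 = 0` makes `g` additive, and continuity makes it linear. -/
theorem eq_linear_of_midpoint_affine {g : ℝ → ℝ} (hg : Continuous g) (h0 : g 0 = 0)
    (h : ∀ s T, g (s - T) + g (s + T) = 2 * g s) (s : ℝ) : g s = s * g 1 := by
  have h2 : ∀ x, g x = 2 * g (x / 2) := fun x => by
    have := h (x / 2) (x / 2)
    rw [sub_self, h0, add_halves, zero_add] at this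
    exact this
  let G : ℝ →+ ℝ := AddMonoidHom.mk' g fun x y => by
    have := h ((x + y) / 2) ((x - y) / 2)
    rw [← h2 (x + y), show (x + y) / 2 - (x - y) / 2 = y by ring,
      show (x + y) / 2 + (x - y) / 2 = x by ring] at this
    linarith
  have := map_real_smul G hg s 1
  simpa [G] using this

/-- `c` and `c'` bound a flat strip in which `c' (-a)` is the point of `c'` nearest to `c 0`. -/
def IsFlatStrip (c c' : ℝ → X) (a B : ℝ) : Prop :=
  ∀ t s, dist (c t) (c' s) ^ 2 = (s - t + a) ^ 2 + B ^ 2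

/-- The flat strip theorem. -/
theorem IsCAT0.exists_isFlatStrip (hX : IsCAT0 X) {c c' : ℝ → X} (hc : Isometry c)
    (hc' : Isometry c') {K : ℝ} (hK : ∀ t, dist (c t) (c' t) ≤ K) :
    ∃ a B, 0 ≤ B ∧ IsFlatStrip c c' a B := by
  -- The distance between points moving at equal speed is convex and bounded, hence constant.
  have hconst : ∀ t s, dist (c t) (c' (t + s)) = dist (c 0) (c' s) := by
    intro t s
    have := eq_of_bounded_of_midpoint_convex (f := fun t => dist (c t) (c' (t + s)))
      (K := K + |s|) (fun t => ?_) (fun t T => ?_) t 0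
    · simpa using this
    · rw [abs_of_nonneg dist_nonneg]
      refine (dist_triangle _ (c' t) _).trans (add_le_add (hK t) ?_)
      rw [hc'.dist_eq, Real.dist_eq, sub_add_cancel_left, abs_neg]
    · have := hX.dist_midpoint_midpoint_le (isMidpoint_of_isometry hc t T)
        (isMidpoint_of_isometry hc' (t + s) T)
      rw [show t + s - T = t - T + s by ring, show t + s + T = t + T + s by ring] at this
      linarith
  set F : ℝ → ℝ := fun s => dist (c 0) (c' s) with hF
  -- The quadrilateral inequality gives `≤`, Bruhat–Tits gives `≥`. Hence `F ^ 2` is a monic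
  -- quadratic polynomial, and completing the square yields `a` and `B`.
  have hjensen : ∀ s T, F (s - T) ^ 2 + F (s + T) ^ 2 = 2 * F s ^ 2 + 2 * T ^ 2 := by
    intro s T
    apply le_antisymm
    · have := hX.quadrilateral (c 0) (c T) (c' (T + s)) (c' s)
      have h1 := hconst T (s - T)
      rw [add_sub_cancel] at h1
      rw [hconst, h1, hc.dist_eq, hc'.dist_eq, dist_comm (c' s), Real.dist_eq, Real.dist_eq,
        sq_abs, sq_abs] at this
      simp only [hF]
      rw [add_comm s T]
      linarith
    · have := hX.dist_sq_le_of_isMidpoint (isMidpoint_of_isometry hc' s T) (c 0)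
      rw [hc'.dist_eq, Real.dist_eq, sq_abs] at this
      simp only [hF]
      linarith
  have hlin := eq_linear_of_midpoint_affine (g := fun s => F s ^ 2 - s ^ 2 - F 0 ^ 2)
    (by have := hc'.continuous; fun_prop) (by simp) (fun s T => by
      have := hjensen s T
      linarith)
  set b := F 1 ^ 2 - 1 ^ 2 - F 0 ^ 2 with hb
  refine ⟨b / 2, F (-(b / 2)), dist_nonneg, fun t s => ?_⟩
  have h1 := hlin (s - t)
  have h2 := hlin (-(b / 2))
  have h3 := hconst t (s - t)
  rw [add_sub_cancel] at h3
  rw [h3]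
  change F (s - t) ^ 2 = _
  linarith

/-- A hypotenuse exceeds its long leg `T + a` by about `B ^ 2 / (2 * (T + a))`: on long diagonals
the width disappears and only the shift `a` remains. -/
theorem IsFlatStrip.dist_le {c c' : ℝ → X} {a B : ℝ} (h : IsFlatStrip c c' a B) {ε : ℝ}
    (hε : 0 < ε) : ∃ T₀ : ℝ, ∀ t T, T₀ ≤ T → dist (c t) (c' (t + T)) ≤ T + a + ε := by
  refine ⟨|a| + B ^ 2 / (2 * ε), fun t T hT => ?_⟩
  have h1 : B ^ 2 / (2 * ε) ≤ T + a := by linarith [neg_abs_le a]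
  have h2 : 0 ≤ T + a := le_trans (by positivity) h1
  rw [div_le_iff₀ (by positivity)] at h1
  refine (abs_le_of_sq_le_sq' ?_ (by linarith)).2
  rw [h, add_sub_cancel_left]
  nlinarith [sq_nonneg ε]

theorem IsFlatStrip.reverse {c c' : ℝ → X} {a B : ℝ} (h : IsFlatStrip c c' a B) :
    IsFlatStrip (fun t => c (-t)) (fun t => c' (-t)) (-a) B := fun t s => by
  rw [h]; ring

theorem IsFlatStrip.swap {c c' : ℝ → X} {a B : ℝ} (h : IsFlatStrip c c' a B) :
    IsFlatStrip c' c (-a) B := fun t s => by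
  rw [dist_comm, h]; ring

/-- The path `c₁ 0`, `c₂ T`, `c₃ (2T)`, `c₁ (3T)` has length at most `3T + a₁ + a₂ + a₃ + ε`, but
its ends are `3T` apart. -/
theorem IsFlatStrip.add_add_nonneg {c₁ c₂ c₃ : ℝ → X} {a₁ a₂ a₃ B₁ B₂ B₃ : ℝ}
    (hc : Isometry c₁) (h₁ : IsFlatStrip c₁ c₂ a₁ B₁) (h₂ : IsFlatStrip c₂ c₃ a₂ B₂)
    (h₃ : IsFlatStrip c₃ c₁ a₃ B₃) : 0 ≤ a₁ + a₂ + a₃ := by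
  refine le_of_forall_pos_le_add fun ε hε => ?_
  obtain ⟨T₁, hT₁⟩ := h₁.dist_le (ε := ε / 3) (by positivity)
  obtain ⟨T₂, hT₂⟩ := h₂.dist_le (ε := ε / 3) (by positivity)
  obtain ⟨T₃, hT₃⟩ := h₃.dist_le (ε := ε / 3) (by positivity)
  obtain ⟨T, hT⟩ : ∃ T, T = max T₁ (max T₂ T₃) := ⟨_, rfl⟩
  have e1 := hT₁ 0 T (by simp [hT])
  have e2 := hT₂ (0 + T) T (by simp [hT])
  have e3 := hT₃ (0 + T + T) T (by simp [hT])
  have e4 := dist_triangle4 (c₁ 0) (c₂ (0 + T)) (c₃ (0 + T + T)) (c₁ (0 + T + T + T))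
  rw [hc.dist_eq, Real.dist_eq] at e4
  have := neg_abs_le (0 - (0 + T + T + T))
  linarith

/-- Reversing all lines changes the sign of the shifts. This cocycle identity provides the
`ℝ`-coordinate on the union of parallel lines. -/
theorem IsFlatStrip.add_add_eq_zero {c₁ c₂ c₃ : ℝ → X} {a₁ a₂ a₃ B₁ B₂ B₃ : ℝ}
    (hc : Isometry c₁) (h₁ : IsFlatStrip c₁ c₂ a₁ B₁) (h₂ : IsFlatStrip c₂ c₃ a₂ B₂)
    (h₃ : IsFlatStrip c₃ c₁ a₃ B₃) : a₁ + a₂ + a₃ = 0 := by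
  have e1 := IsFlatStrip.add_add_nonneg hc h₁ h₂ h₃
  have e2 := IsFlatStrip.add_add_nonneg (hc.comp (IsometryEquiv.neg ℝ).isometry) h₁.reverse
    h₂.reverse h₃.reverse
  linarith

/-! ### Angles -/

theorem GeodesicRay.isGeodesicPath (c : GeodesicRay X) {l : ℝ} (hl : 0 ≤ l) :
    IsGeodesicPath (fun t => c t.toNNReal) l (c 0) (c l.toNNReal) where
  nonneg := hl
  source := by simp
  target := rfl
  dist_eq s hs t ht := by
    have := c.2.dist_eq s.toNNReal t.toNNReal
    rw [NNReal.dist_eq, Real.coe_toNNReal _ hs.1, Real.coe_toNNReal _ ht.1] at this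
    exact this

theorem GeodesicRay.dist_zero_apply (c : GeodesicRay X) (r : ℝ≥0) : dist (c 0) (c r) = r := by
  rw [c.2.dist_eq, NNReal.dist_eq]; simp

theorem IsCAT0.comparisonAngle_mono (hX : IsCAT0 X) (c c' : GeodesicRay X) (h0 : c 0 = c' 0)
    {s t S T : ℝ≥0} (hs : 0 < s) (ht : 0 < t) (hsS : s ≤ S) (htT : t ≤ T) :
    comparisonAngle (c 0) (c s) (c' t) ≤ comparisonAngle (c 0) (c S) (c' T) := by
  have hS : 0 < S := hs.trans_le hsS
  have hT : 0 < T := ht.trans_le htT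
  have hd := c.dist_zero_apply
  have hd' : ∀ r, dist (c 0) (c' r) = r := fun r => by rw [h0, c'.dist_zero_apply]
  have hg' := c'.isGeodesicPath T.2
  rw [← h0] at hg'
  have key := hX.comparison_sq (c.isGeodesicPath S.2) hg' (by exact_mod_cast hS)
    (by exact_mod_cast hT) (s := s) (t := t) ⟨s.2, by exact_mod_cast hsS⟩
    ⟨t.2, by exact_mod_cast htT⟩
  simp only [NNReal.val_eq_coe, Real.toNNReal_coe] at key
  have hs' : (0 : ℝ) < s := hs
  have ht' : (0 : ℝ) < t := ht
  have hS' : (0 : ℝ) < S := hS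
  have hT' : (0 : ℝ) < T := hT
  apply Real.arccos_le_arccos
  rw [hd, hd', hd, hd', le_div_iff₀ (by positivity)]
  refine le_trans (le_of_eq ?_) (le_sub_comm.1 key)
  field_simp

/-- Monotonicity of comparison angles bounds the limit at the vertex by data arbitrarily far out on
the rays. -/
theorem IsCAT0.alexandrovAngle_le (hX : IsCAT0 X) (c c' : GeodesicRay X) (h0 : c 0 = c' 0)
    {S T : ℝ≥0} (hS : 0 < S) (hT : 0 < T) :
    alexandrovAngle c c' ≤ comparisonAngle (c 0) (c S) (c' T) := by
  have hS' : Ioc 0 S ∈ 𝓝[>] (0 : ℝ≥0) := Ioc_mem_nhdsGT hS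
  have hT' : Ioc 0 T ∈ 𝓝[>] (0 : ℝ≥0) := Ioc_mem_nhdsGT hT
  refine limsup_le_of_le ?_ ?_
  · exact isCoboundedUnder_le_of_le _ (x := 0) fun _ => Real.arccos_nonneg _
  · filter_upwards [prod_mem_prod hS' hT'] with u hu
    exact hX.comparisonAngle_mono c c' h0 hu.1.1 hu.2.1 hu.1.2 hu.2.2

end Metric

/-! ### Displacement -/

section Action

variable {G X : Type*} [Group G] [MetricSpace X] [MulAction G X]

/-- By cocompactness it suffices to minimize the displacements of the conjugates of `h` over `K`. By
proper discontinuity only finitely many conjugates move some point of `K` by at most `dist x₀ (h •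
x₀)`. -/
theorem IsGeometricAction.nonempty_minSet [Nonempty X] (hX : IsCAT0 X)
    (hG : IsGeometricAction G X) (h : G) : (minSet fun x : X => h • x).Nonempty := by
  have := hX.proper
  have := hG.isometric
  have := hG.properlyDiscontinuous
  obtain ⟨K, hK, hKG⟩ := hG.cocompact
  have hcover : ∀ y : X, ∃ g : G, ∃ k ∈ K, g • k = y := fun y => by
    have hy : y ∈ ⋃ g : G, g • K := hKG ▸ mem_univ y
    obtain ⟨g, hg⟩ := mem_iUnion.1 hy
    exact ⟨g, hg⟩
  obtain ⟨-, x₀, hx₀, -⟩ := hcover (Classical.arbitrary X)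
  obtain ⟨R, hR⟩ := hK.isBounded.subset_closedBall x₀
  set K' : Set X := Metric.closedBall x₀ (R + dist x₀ (h • x₀))
  have hK' : IsCompact K' := isCompact_closedBall _ _
  have hR0 : 0 ≤ R := by simpa using hR hx₀
  set S : Set G := {γ | (∃ g : G, γ = g⁻¹ * h * g) ∧ ((γ • ·) '' K' ∩ K').Nonempty}
  have hS : S.Finite :=
    (ProperlyDiscontinuousSMul.finite_disjoint_inter_image hK' hK').subset fun γ hγ => hγ.2
  have hmem : ∀ γ : G, (∃ g : G, γ = g⁻¹ * h * g) → ∀ k ∈ K,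
      dist k (γ • k) ≤ dist x₀ (h • x₀) → γ ∈ S := fun γ hγ k hk hd => by
    have hkR : dist k x₀ ≤ R := hR hk
    refine ⟨hγ, γ • k, ⟨k, ?_, rfl⟩, ?_⟩
    · exact hkR.trans (le_add_of_nonneg_right dist_nonneg)
    · have := dist_triangle (γ • k) k x₀
      rw [dist_comm (γ • k) k] at this
      exact this.trans (by linarith)
  have hhS : h ∈ S := hmem h ⟨1, by simp⟩ x₀ hx₀ le_rfl
  have hmin : ∀ γ : G, ∃ k ∈ K, ∀ k' ∈ K, dist k (γ • k) ≤ dist k' (γ • k') := fun γ =>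
    hK.exists_isMinOn ⟨x₀, hx₀⟩
      (continuous_id.dist (isometry_smul X γ).continuous).continuousOn
  choose k hkK hk using hmin
  obtain ⟨γ₀, ⟨⟨g₀, rfl⟩, -⟩, hγ₀⟩ := S.exists_min_image (fun γ => dist (k γ) (γ • k γ)) hS ⟨h, hhS⟩
  have hconj : ∀ (g : G) (x : X), dist (g • x) (h • g • x) = dist x ((g⁻¹ * h * g) • x) :=
    fun g x => by
      rw [← dist_smul g x, smul_smul, smul_smul, mul_assoc, mul_inv_cancel_left]
  refine ⟨g₀ • k (g₀⁻¹ * h * g₀), fun y => ?_⟩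
  obtain ⟨g, y, hy, rfl⟩ := hcover y
  simp only [hconj]
  by_cases hgS : g⁻¹ * h * g ∈ S
  · exact (hγ₀ _ hgS).trans (hk _ _ hy)
  · have h1 : dist x₀ (h • x₀) < dist y ((g⁻¹ * h * g) • y) := by
      by_contra! h2
      exact hgS (hmem _ ⟨g, rfl⟩ y hy h2)
    exact ((hγ₀ _ hhS).trans (hk _ _ hx₀)).trans h1.le

theorem IsGeometricAction.smul_ne (hG : IsGeometricAction G X) {h : G}
    (hh : Function.Injective fun n : ℕ => h ^ n) (x : X) : h • x ≠ x := by
  intro hx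
  have := hG.properlyDiscontinuous
  have hpow : ∀ n : ℕ, h ^ n • x = x := fun n => by
    induction n with
    | zero => simp
    | succ n ih => rw [pow_succ, mul_smul, hx, ih]
  have hfin := ProperlyDiscontinuousSMul.finite_disjoint_inter_image (Γ := G)
    (isCompact_singleton (x := x)) (isCompact_singleton (x := x))
  refine infinite_range_of_injective hh (hfin.subset ?_)
  rintro _ ⟨n, rfl⟩
  exact ⟨x, ⟨x, rfl, hpow n⟩, rfl⟩

theorem TranslatesLine.smul_eq {h : G} {c : ℝ → X} {l : ℝ}
    (hc : TranslatesLine (fun x : X => h • x) c l) (t : ℝ) : h • c t = c (t + l) :=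
  hc.2 t

theorem TranslatesLine.pow_smul {h : G} {c : ℝ → X} {l : ℝ}
    (hc : TranslatesLine (fun x : X => h • x) c l) (n : ℕ) (t : ℝ) :
    h ^ n • c t = c (t + n * l) := by
  induction n with
  | zero => simp
  | succ n ih =>
    rw [pow_succ', mul_smul, ih, hc.smul_eq]
    push_cast
    ring_nf

variable [IsIsometricSMul G X]

theorem dist_pow_smul_le (h : G) (x : X) (n : ℕ) : dist x (h ^ n • x) ≤ n * dist x (h • x) := by
  induction n with
  | zero => simp
  | succ n ih =>
    have := dist_triangle x (h ^ n • x) (h ^ (n + 1) • x)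
    rw [pow_succ h n, mul_smul, dist_smul, ← mul_smul, ← pow_succ] at this
    push_cast
    linarith

/-- `h` carries the midpoint of `x, h x` to that of `h x, h² x`, and these midpoints are at most
half of `d(x, h² x)` apart. -/
theorem IsCAT0.two_mul_le_dist_sq_smul (hX : IsCAT0 X) {h : G} {l : ℝ}
    (hl : ∀ x : X, l ≤ dist x (h • x)) (x : X) : 2 * l ≤ dist x (h ^ 2 • x) := by
  obtain ⟨m, hm⟩ := hX.exists_isMidpoint x (h • x)
  have hm' : IsMidpoint (h • m) (h • x) (h ^ 2 • x) := by
    rw [pow_two, mul_smul]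
    exact ⟨by rw [dist_smul, dist_smul]; exact hm.1, by rw [dist_smul, dist_smul]; exact hm.2⟩
  have := hX.dist_midpoint_le hm.symm hm'
  linarith [hl m]

theorem IsCAT0.dist_pow_smul (hX : IsCAT0 X) {h : G} {x : X}
    (hx : x ∈ minSet fun x : X => h • x) (n : ℕ) :
    dist x (h ^ n • x) = n * dist x (h • x) := by
  set l := dist x (h • x) with hl
  have h2 : ∀ k : ℕ, ∀ y : X, 2 ^ k * l ≤ dist y (h ^ 2 ^ k • y) := fun k => by
    induction k with
    | zero => intro y; simpa using hx y
    | succ k ih =>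
      intro y
      have := hX.two_mul_le_dist_sq_smul ih y
      rw [← pow_mul, ← pow_succ] at this
      rw [pow_succ]
      linarith
  refine le_antisymm (dist_pow_smul_le h x n) ?_
  -- Doubling settles the powers of two. Writing `2 ^ n = n + j`, a shortfall at `n` would give one
  -- at `2 ^ n`.
  obtain ⟨j, hj⟩ := Nat.exists_eq_add_of_le (Nat.lt_two_pow_self (n := n)).le
  have h3 := h2 n x
  have h4 := dist_triangle x (h ^ n • x) (h ^ (n + j) • x)
  rw [pow_add, mul_smul, dist_smul, ← mul_smul, ← pow_add, ← hj] at h4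
  have h5 := dist_pow_smul_le h x j
  have h6 : (2 : ℝ) ^ n = n + j := by exact_mod_cast hj
  rw [h6] at h3
  linarith

theorem IsCAT0.dist_zpow_smul (hX : IsCAT0 X) {h : G} {x : X}
    (hx : x ∈ minSet fun x : X => h • x) (i j : ℤ) :
    dist (h ^ i • x) (h ^ j • x) = |(i : ℝ) - j| * dist x (h • x) := by
  wlog hij : i ≤ j generalizing i j
  · rw [dist_comm, this j i (by omega), abs_sub_comm]
  obtain ⟨n, rfl⟩ := Int.le.dest hij
  rw [zpow_add, mul_smul, dist_smul, zpow_natCast, hX.dist_pow_smul hx]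
  simp

/-! ### Existence of axes -/

/-- The translates of a geodesic from `x` to `h x` are concatenated. A shortcut would bring two
orbit points closer than `dist_zpow_smul` allows. -/
theorem IsCAT0.exists_translatesLine (hX : IsCAT0 X) {h : G} {x : X}
    (hx : x ∈ minSet fun x : X => h • x) (hne : h • x ≠ x) :
    ∃ c : ℝ → X, TranslatesLine (fun x : X => h • x) c (dist x (h • x)) ∧ c 0 = x := by
  obtain ⟨γ, l, hγ⟩ := hX.geodesic x (h • x)
  have hl := hγ.length_eq
  rw [← hl]
  have hl0 : 0 < l := hl ▸ dist_pos.2 hne.symm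
  set c : ℝ → X := fun t => h ^ ⌊t / l⌋ • γ (t - ⌊t / l⌋ * l) with hc
  have hmem : ∀ t : ℝ, t - ⌊t / l⌋ * l ∈ Icc 0 l := fun t => by
    have h1 := Int.floor_le (t / l)
    have h2 := (Int.lt_floor_add_one (t / l)).le
    rw [le_div_iff₀ hl0] at h1
    rw [div_le_iff₀ hl0] at h2
    constructor <;> linarith
  have hshift : ∀ t, h • c t = c (t + l) := fun t => by
    simp only [hc]
    rw [add_div, div_self hl0.ne', Int.floor_add_one, add_comm ⌊t / l⌋, zpow_add, zpow_one,
      mul_smul]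
    congr 3
    push_cast
    ring
  have hmul : ∀ k : ℤ, c (k * l) = h ^ k • x := fun k => by
    simp only [hc]
    rw [mul_div_cancel_right₀ _ hl0.ne', Int.floor_intCast, sub_self, hγ.source]
  have hleft : ∀ t, dist (h ^ ⌊t / l⌋ • x) (c t) = t - ⌊t / l⌋ * l := fun t => by
    simp only [hc]
    rw [dist_smul, hγ.dist_source (hmem t)]
  have hright : ∀ t, dist (c t) (h ^ (⌊t / l⌋ + 1) • x) = (⌊t / l⌋ + 1) * l - t := fun t => by
    simp only [hc]
    have := hγ.dist_eq _ (hmem t) l ⟨hl0.le, le_rfl⟩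
    rw [zpow_add, zpow_one, mul_smul, dist_smul, ← hγ.target, this, abs_sub_comm,
      abs_of_nonneg (sub_nonneg.2 (hmem t).2)]
    ring
  have hlip : ∀ s t, s ≤ t → dist (c s) (c t) ≤ t - s := fun s t hst => by
    rcases (Int.floor_mono (div_le_div_of_nonneg_right hst hl0.le)).eq_or_lt with heq | hlt
    · simp only [hc]
      have ht := hmem t
      rw [← heq] at ht
      rw [← heq, dist_smul, hγ.dist_eq _ (hmem s) _ ht, sub_sub_sub_cancel_right, abs_sub_comm,
        abs_of_nonneg (sub_nonneg.2 hst)]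
    · have h1 := dist_triangle4 (c s) (h ^ (⌊s / l⌋ + 1) • x) (h ^ ⌊t / l⌋ • x) (c t)
      have h2 : ((⌊s / l⌋ + 1 : ℤ) : ℝ) ≤ (⌊t / l⌋ : ℤ) := by exact_mod_cast hlt
      rw [hright, hleft, hX.dist_zpow_smul hx, ← hl, abs_sub_comm,
        abs_of_nonneg (sub_nonneg.2 h2)] at h1
      push_cast at h1
      linarith
  have hdist : ∀ s t, s ≤ t → dist (c s) (c t) = t - s := fun s t hst => by
    refine le_antisymm (hlip s t hst) ?_
    have h1 := hleft s
    have h2 := hright t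
    have h3 := dist_triangle4 (h ^ ⌊s / l⌋ • x) (c s) (c t) (h ^ (⌊t / l⌋ + 1) • x)
    rw [h1, h2, hX.dist_zpow_smul hx, ← hl] at h3
    have h4 := neg_abs_le ((⌊s / l⌋ : ℝ) - ((⌊t / l⌋ + 1 : ℤ) : ℝ))
    push_cast at h3 h4
    nlinarith
  refine ⟨c, ⟨Isometry.of_dist_eq fun s t => ?_, hshift⟩, by simpa using hmul 0⟩
  rw [Real.dist_eq]
  rcases le_total s t with hst | hst
  · rw [hdist s t hst, abs_sub_comm, abs_of_nonneg (sub_nonneg.2 hst)]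
  · rw [dist_comm, hdist t s hst, abs_of_nonneg (sub_nonneg.2 hst)]

/-! ### Comparison of axes -/

theorem TranslatesLine.reverse {h : X → X} {c : ℝ → X} {l : ℝ} (hc : TranslatesLine h c l) :
    TranslatesLine h (fun t => c (-t)) (-l) :=
  ⟨hc.1.comp (IsometryEquiv.neg ℝ).isometry, fun t => by rw [hc.2]; congr 1; ring⟩

/-- `|l|` is the linear growth rate of every orbit of `h`, whatever its base point; letting `n` grow
removes the constant `2 * dist (c 0) y`. -/
theorem TranslatesLine.abs_le_dist {h : G} {c : ℝ → X} {l : ℝ}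
    (hc : TranslatesLine (fun x : X => h • x) c l) (y : X) : |l| ≤ dist y (h • y) := by
  refine le_of_forall_pos_le_add fun ε hε => ?_
  obtain ⟨n, hn⟩ := exists_nat_gt (2 * dist (c 0) y / ε)
  rw [div_lt_iff₀ hε] at hn
  have hn0 : 0 < (n : ℝ) := by
    by_contra! h0
    nlinarith [dist_nonneg (x := c 0) (y := y)]
  have h1 := dist_triangle4 (c 0) y (h ^ n • y) (h ^ n • c 0)
  rw [dist_smul, hc.pow_smul, hc.1.dist_eq, dist_comm y (c 0), Real.dist_eq, zero_add, zero_sub,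
    abs_neg, abs_mul, Nat.abs_cast] at h1
  have h2 := dist_pow_smul_le h y n
  refine le_of_mul_le_mul_left ?_ hn0
  linarith

theorem TranslatesLine.mem_minSet {h : G} {c : ℝ → X} {l : ℝ}
    (hc : TranslatesLine (fun x : X => h • x) c l) (t : ℝ) :
    c t ∈ minSet fun x : X => h • x := fun y => by
  have h1 := hc.abs_le_dist y
  have h2 := hc.2 t
  simp only at h2 ⊢
  rw [h2, hc.1.dist_eq, Real.dist_eq, sub_add_cancel_left, abs_neg]
  exact h1

theorem TranslatesLine.abs_eq {h : G} {c c' : ℝ → X} {l l' : ℝ}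
    (hc : TranslatesLine (fun x : X => h • x) c l)
    (hc' : TranslatesLine (fun x : X => h • x) c' l') : |l| = |l'| := by
  have key : ∀ {c c' : ℝ → X} {l l' : ℝ}, TranslatesLine (fun x : X => h • x) c l →
      TranslatesLine (fun x : X => h • x) c' l' → |l| ≤ |l'| := fun {c c' l l'} hc hc' => by
    have h1 := hc.abs_le_dist (c' 0)
    have h2 := hc'.2 0
    simp only at h2
    rw [h2, hc'.1.dist_eq, Real.dist_eq] at h1
    simpa using h1
  exact le_antisymm (key hc hc') (key hc' hc)

/-- The distance is continuous and `l`-periodic in `t`. -/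
theorem TranslatesLine.exists_dist_le {h : G} {c c' : ℝ → X} {l : ℝ} (hl : l ≠ 0)
    (hc : TranslatesLine (fun x : X => h • x) c l)
    (hc' : TranslatesLine (fun x : X => h • x) c' l) :
    ∃ K, ∀ t, dist (c t) (c' t) ≤ K := by
  have hper : Function.Periodic (fun t => dist (c t) (c' t)) l := fun t => by
    simp only
    rw [← hc.2, ← hc'.2]
    exact dist_smul h _ _
  obtain ⟨K, hK⟩ := (hper.compact_of_continuous hl
    (hc.1.continuous.dist hc'.1.continuous)).bddAbove
  exact ⟨K, fun t => hK ⟨t, rfl⟩⟩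

theorem existsUnique_isForwardEndpoint [Nonempty X] (hX : IsCAT0 X)
    (hG : IsGeometricAction G X) {h : G} (hh : Function.Injective fun n : ℕ => h ^ n) :
    ∃! ξ : IdealBoundary X, IsForwardEndpoint (fun x => h • x) ξ := by
  obtain ⟨x, hx⟩ := hG.nonempty_minSet hX h
  obtain ⟨c, hc, -⟩ := hX.exists_translatesLine hx (hG.smul_ne hh x)
  have hl : 0 < dist x (h • x) := dist_pos.2 (hG.smul_ne hh x).symm
  refine ⟨_, ⟨c, _, hc, hl, rfl⟩, ?_⟩
  rintro _ ⟨c', l', hc', hl', rfl⟩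
  have heq := hc.abs_eq hc'
  rw [abs_of_pos hl, abs_of_pos hl'] at heq
  rw [heq] at hc
  obtain ⟨K, hK⟩ := hc'.exists_dist_le hl'.ne' hc
  exact Quotient.sound ⟨K, fun t => hK t⟩

end Action

/-! ### The splitting of the minimal set -/

theorem WithLp.prod_dist_sq {Z : Type*} [MetricSpace Z] (x y : WithLp 2 (Z × ℝ)) :
    dist x y ^ 2 = dist x.fst y.fst ^ 2 + (x.snd - y.snd) ^ 2 := by
  have h : dist x y = √(dist x.fst y.fst ^ 2 + dist x.snd y.snd ^ 2) := by
    rw [WithLp.prod_dist_eq_add (by norm_num), Real.sqrt_eq_rpow]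
    norm_num
  rw [h, Real.sq_sqrt (by positivity), Real.dist_eq, sq_abs]

section Splitting

variable {G : Type*} {X : Type u} [Group G] [MetricSpace X] [MulAction G X] [IsIsometricSMul G X]

/-- In a flat strip `dist (c t) (c' t)` does not depend on `t`. -/
theorem TranslatesLine.eq_of_apply_zero_eq (hX : IsCAT0 X) {h : G} {c c' : ℝ → X} {l : ℝ}
    (hl : l ≠ 0) (hc : TranslatesLine (fun x : X => h • x) c l)
    (hc' : TranslatesLine (fun x : X => h • x) c' l) (h0 : c 0 = c' 0) : c = c' := by
  obtain ⟨K, hK⟩ := hc.exists_dist_le hl hc'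
  obtain ⟨a, B, -, hs⟩ := hX.exists_isFlatStrip hc.1 hc'.1 hK
  have h1 := hs 0 0
  rw [h0, dist_self] at h1
  funext t
  have h2 := hs t t
  rw [sub_self] at h1 h2
  exact dist_eq_zero.1 ((pow_eq_zero_iff two_ne_zero).1 (by linarith))

theorem TranslatesLine.shift {h : X → X} {c : ℝ → X} {l : ℝ} (hc : TranslatesLine h c l)
    (s : ℝ) : TranslatesLine h (fun t => c (s + t)) l :=
  ⟨hc.1.comp (IsometryEquiv.addLeft s).isometry, fun t => by rw [hc.2, add_assoc]⟩

theorem IsAxis.exists_pos {h : X → X} {L : Set X} (hL : IsAxis h L) :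
    ∃ (c : ℝ → X) (l : ℝ), TranslatesLine h c l ∧ 0 < l ∧ range c = L := by
  obtain ⟨c, l, hc, hl, rfl⟩ := hL
  rcases hl.lt_or_gt with hl | hl
  · exact ⟨_, _, hc.reverse, neg_pos.2 hl, (Equiv.neg ℝ).surjective.range_comp c⟩
  · exact ⟨c, l, hc, hl, rfl⟩

theorem IsCAT0.exists_isMinSplitting (hX : IsCAT0 X) {h : G}
    (hmin : (minSet fun x : X => h • x).Nonempty) (hne : ∀ x : X, h • x ≠ x) :
    ∃ (Z : Type u) (_ : MetricSpace Z) (e : minSet (fun x : X => h • x) ≃ᵢ WithLp 2 (Z × ℝ)),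
      IsMinSplitting (fun x : X => h • x) e := by
  set M := minSet fun x : X => h • x with hM
  obtain ⟨x₀, hx₀⟩ := hmin
  set l := dist x₀ (h • x₀) with hl
  have hl0 : 0 < l := dist_pos.2 (hne x₀).symm
  have hex : ∀ x : M, ∃ c : ℝ → X, TranslatesLine (fun x : X => h • x) c l ∧ c 0 = x := fun x => by
    rw [hl, le_antisymm (hx₀ x) (x.2 x₀)]
    exact hX.exists_translatesLine x.2 (hne x)
  choose c hc hc0 using hex
  have hstrip : ∀ x y : M, ∃ a B, IsFlatStrip (c x) (c y) a B := fun x y => by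
    obtain ⟨K, hK⟩ := (hc x).exists_dist_le hl0.ne' (hc y)
    obtain ⟨a, B, -, hs⟩ := hX.exists_isFlatStrip (hc x).1 (hc y).1 hK
    exact ⟨a, B, hs⟩
  choose a B haB using hstrip
  -- The cocycle of shifts is the coboundary of `β`. The level set `β = 0` meets each axis once and
  -- serves as `Z`; the strip formula is then the `ℓ²` metric.
  set β : M → ℝ := fun x => a ⟨x₀, hx₀⟩ x with hβ
  have ha : ∀ x y, a x y = β y - β x := fun x y => by
    have := IsFlatStrip.add_add_eq_zero (hc _).1 (haB ⟨x₀, hx₀⟩ x) (haB x y)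
      (haB ⟨x₀, hx₀⟩ y).swap
    simp only [hβ]
    linarith
  set P : M → ℝ → M := fun x t => ⟨c x t, (hc x).mem_minSet t⟩ with hP
  have hline : ∀ x t s, c (P x t) s = c x (t + s) := fun x t s =>
    congrFun (TranslatesLine.eq_of_apply_zero_eq hX hl0.ne' (hc _) ((hc x).shift t)
      (by rw [hc0, add_zero])) s
  have hβP : ∀ x t, β (P x t) = β x + t := fun x t => by
    have h1 := haB x (P x t) t 0
    rw [hline, add_zero, dist_self, ha] at h1
    nlinarith [sq_nonneg (B x (P x t)), sq_nonneg (0 - t + (β (P x t) - β x))]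
  let Z : Type u := {z : M // β z = 0}
  let f : WithLp 2 (Z × ℝ) → M := fun w => P w.fst.1 w.snd
  let g : M → WithLp 2 (Z × ℝ) := fun x =>
    WithLp.toLp 2 (⟨P x (-β x), by rw [hβP, add_neg_cancel]⟩, β x)
  have hf : Isometry f := Isometry.of_dist_eq fun w w' => by
    have h1 := haB w.fst.1 w'.fst.1
    have h2 := h1 0 0
    have h3 := h1 w.snd w'.snd
    rw [hc0, hc0] at h2
    rw [ha, w.fst.2, w'.fst.2] at h2 h3
    have h4 := WithLp.prod_dist_sq w w'
    have h5 : dist (f w) (f w') ^ 2 = dist w w' ^ 2 := by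
      rw [h4]
      change dist (c _ _) (c _ _) ^ 2 = dist (w.fst.1 : X) w'.fst.1 ^ 2 + _
      rw [h3, h2]
      ring
    exact (pow_left_inj₀ dist_nonneg dist_nonneg two_ne_zero).1 h5
  have hfg : ∀ x, f (g x) = x := fun x => Subtype.ext <| by
    change c (P x (-β x)) (β x) = x
    rw [hline, neg_add_cancel, hc0]
  refine ⟨Z, inferInstance, (IsometryEquiv.mk' f g hfg hf).symm, fun L => ⟨fun hL => ?_, ?_⟩⟩
  · obtain ⟨c', l', hc', hl', rfl⟩ := hL.exists_pos
    have hll := hc'.abs_eq (hc ⟨x₀, hx₀⟩)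
    rw [abs_of_pos hl0, abs_of_pos hl'] at hll
    subst hll
    obtain ⟨x, hx⟩ : ∃ x : M, (x : X) = c' 0 := ⟨⟨_, hc'.mem_minSet 0⟩, rfl⟩
    have heq := TranslatesLine.eq_of_apply_zero_eq hX hl'.ne' hc' (hc x) (by rw [hc0, hx])
    refine ⟨⟨P x (-β x), by rw [hβP, add_neg_cancel]⟩, ?_⟩
    change _ = range fun t => c (P x (-β x)) t
    simp only [hline, heq]
    exact ((Equiv.addLeft (-β x)).surjective.range_comp (c x)).symm
  · rintro ⟨z, rfl⟩
    exact ⟨c z.1, l, hc _, hl0.ne', rfl⟩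

end Splitting

/-! ### The action on a splitting -/

/-- The change of parameter is an isometric embedding of `ℝ` into itself, hence `t ↦ ± t + r`. -/
theorem exists_sign_of_range_subset {X : Type*} [MetricSpace X] {c c' : ℝ → X} (hc : Isometry c)
    (hc' : Isometry c') (h : range c' ⊆ range c) :
    ∃ ε r : ℝ, ε * ε = 1 ∧ ∀ t, c' t = c (ε * t + r) := by
  choose f hf using fun t => h ⟨t, rfl⟩
  have hd : ∀ s t, (f s - f t) ^ 2 = (s - t) ^ 2 := fun s t => by
    rw [← sq_abs, ← sq_abs (s - t), ← Real.dist_eq, ← Real.dist_eq, ← hc.dist_eq, hf, hf,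
      hc'.dist_eq]
  refine ⟨f 1 - f 0, f 0, by have := hd 1 0; nlinarith, fun t => ?_⟩
  rw [← hf]
  congr 1
  have h1 := hd 1 0
  have h2 := hd t 0
  have h3 := hd t 1
  have h4 : (f t - f 0) * (f 1 - f 0) = t := by nlinarith
  calc f t = (f 1 - f 0) * ((f t - f 0) * (f 1 - f 0)) + f 0 := by
        have : (f t - f 0) * (f 1 - f 0) ^ 2 = f t - f 0 := by rw [h1]; ring
        linarith
    _ = _ := by rw [h4]

section Splitting

variable {G : Type*} {X : Type u} {Z : Type v} [Group G] [MetricSpace X] [MetricSpace Z]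
  [MulAction G X]

/-- The line `{z} × ℝ` of a splitting of the minimal set. -/
noncomputable def splitLine {h : X → X} (e : minSet h ≃ᵢ WithLp 2 (Z × ℝ)) (z : Z) (t : ℝ) : X :=
  e.symm (WithLp.toLp 2 (z, t))

theorem dist_splitLine_sq {h : X → X} (e : minSet h ≃ᵢ WithLp 2 (Z × ℝ)) (z w : Z) (t s : ℝ) :
    dist (splitLine e z t) (splitLine e w s) ^ 2 = dist z w ^ 2 + (t - s) ^ 2 := by
  rw [splitLine, splitLine, ← Subtype.dist_eq, e.symm.dist_eq]
  exact WithLp.prod_dist_sq _ _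

theorem isometry_splitLine {h : X → X} (e : minSet h ≃ᵢ WithLp 2 (Z × ℝ)) (z : Z) :
    Isometry (splitLine e z) := Isometry.of_dist_eq fun t s => by
  have := dist_splitLine_sq e z z t s
  rw [dist_self, zero_pow two_ne_zero, zero_add] at this
  rw [Real.dist_eq, ← Real.sqrt_sq_eq_abs, ← this, Real.sqrt_sq dist_nonneg]

theorem splitLine_mem {h : X → X} (e : minSet h ≃ᵢ WithLp 2 (Z × ℝ)) (z : Z) (t : ℝ) :
    splitLine e z t ∈ minSet h := Subtype.coe_prop _

theorem splitLine_apply {h : X → X} (e : minSet h ≃ᵢ WithLp 2 (Z × ℝ)) (x : minSet h) :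
    splitLine e (e x).fst (e x).snd = x :=
  congrArg Subtype.val (e.symm_apply_apply x)

theorem apply_splitLine_snd {h : X → X} (e : minSet h ≃ᵢ WithLp 2 (Z × ℝ)) {z : Z} {t : ℝ} {x : X}
    (hx : x = splitLine e z t) (hmem : x ∈ minSet h) : (e ⟨x, hmem⟩).snd = t := by
  subst hx
  exact congrArg WithLp.snd (e.apply_symm_apply (WithLp.toLp 2 (z, t)))

theorem IsMinSplitting.exists_translatesLine {h : X → X} {e : minSet h ≃ᵢ WithLp 2 (Z × ℝ)}
    (he : IsMinSplitting h e) (z : Z) : ∃ l, l ≠ 0 ∧ TranslatesLine h (splitLine e z) l := by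
  obtain ⟨c, l, hc, hl, hr⟩ := (he (range (splitLine e z))).2 ⟨z, rfl⟩
  obtain ⟨ε, r, hε, h1⟩ := exists_sign_of_range_subset hc.1 (isometry_splitLine e z) hr.ge
  refine ⟨ε * l, mul_ne_zero (fun h0 => by simp [h0] at hε) hl, isometry_splitLine e z,
    fun t => ?_⟩
  rw [h1, h1, hc.2]
  congr 1
  linear_combination (-l) * hε

variable [IsIsometricSMul G X]

theorem IsMinSplitting.exists_hom {h : G} {e : minSet (fun x : X => h • x) ≃ᵢ WithLp 2 (Z × ℝ)}
    (he : IsMinSplitting (fun x : X => h • x) e) (hcomm : ∀ g, g * h = h * g) (z₀ : Z) :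
    ∃ lam : G →* Multiplicative ℝ,
      (∀ g z, ∃ z', ∀ t, g • splitLine e z t = splitLine e z' (t + (lam g).toAdd)) ∧
      (∀ z, TranslatesLine (fun x : X => h • x) (splitLine e z) (lam h).toAdd) ∧
      (lam h).toAdd ≠ 0 := by
  choose l hl0 hl using he.exists_translatesLine
  have hll : ∀ z w, l z = l w := fun z w => by
    have key : ∀ t s, (t + l z - (s + l w)) ^ 2 = (t - s) ^ 2 := fun t s => by
      have h1 := dist_splitLine_sq e z w (t + l z) (s + l w)
      rw [← (hl z).smul_eq, ← (hl w).smul_eq, dist_smul, dist_splitLine_sq] at h1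
      linarith
    have h1 := key 1 0
    have h2 := key 0 0
    nlinarith
  have hline : ∀ (g : G) z, ∃ z' r, ∀ t, g • splitLine e z t = splitLine e z' (t + r) := fun g z => by
    have htr : TranslatesLine (fun x : X => h • x) (fun t => g • splitLine e z t) (l z) :=
      ⟨(isometry_smul X g).comp (isometry_splitLine e z), fun t => by
        change h • g • _ = g • splitLine e z (t + l z)
        rw [← (hl z).smul_eq, smul_smul, smul_smul, hcomm]⟩
    obtain ⟨z', hz'⟩ := (he _).1 ⟨_, _, htr, hl0 z, rfl⟩
    obtain ⟨ε, r, hε, h1⟩ := exists_sign_of_range_subset (isometry_splitLine e z') htr.1 hz'.le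
    refine ⟨z', r, fun t => ?_⟩
    have h2 := htr.smul_eq t
    rw [h1, h1, (hl z').smul_eq, hll z' z] at h2
    have h3 := (isometry_splitLine e z').injective h2
    -- `g` commutes with `h`, and `h` translates all lines by the same nonzero amount, so `g` cannot
    -- reverse them.
    have h4 : ε = 1 := by
      have : (ε - 1) * l z = 0 := by linarith
      rcases mul_eq_zero.1 this with h5 | h5
      · linarith
      · exact absurd h5 (hl0 z)
    rw [h1, h4, one_mul]
  choose σ r hr using hline
  -- Comparing `t - s = 1` with `t - s = -1` eliminates the unknown distance in `Z` and leaves equal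
  -- shifts.
  have hrr : ∀ g z w, r g z = r g w := fun g z w => by
    have key : ∀ t s, dist (σ g z) (σ g w) ^ 2 + (t + r g z - (s + r g w)) ^ 2 =
        dist z w ^ 2 + (t - s) ^ 2 := fun t s => by
      rw [← dist_splitLine_sq e, ← hr, ← hr, dist_smul, dist_splitLine_sq]
    have h1 := key 1 0
    have h2 := key 0 1
    nlinarith
  have huniq : ∀ {g : G} {z z' : Z} {d : ℝ}, (∀ t, g • splitLine e z t = splitLine e z' (t + d)) →
      r g z₀ = d := fun {g z z' d} h1 => by
    have key : ∀ t, dist (σ g z) z' ^ 2 + (t + r g z - (0 + d)) ^ 2 = t ^ 2 := fun t => by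
      rw [← dist_splitLine_sq e, ← hr, ← h1, dist_smul, dist_splitLine_sq, dist_self]
      ring
    have h2 := key 1
    have h3 := key (-1)
    rw [hrr g z₀ z]
    linarith
  let lam : G →* Multiplicative ℝ := MonoidHom.mk' (fun g => Multiplicative.ofAdd (r g z₀))
    fun g g' => by
      rw [← ofAdd_add]
      congr 1
      refine huniq (z := z₀) (z' := σ g (σ g' z₀)) fun t => ?_
      rw [mul_smul, hr, hr, hrr g _ z₀]
      congr 1
      ring
  have hlam : ∀ g z, (lam g).toAdd = r g z := fun g z => hrr g z₀ z
  have hlh : ∀ z, (lam h).toAdd = l z := fun z => huniq (hl z).smul_eq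
  refine ⟨lam, fun g z => ⟨σ g z, fun t => ?_⟩, fun z => ?_, ?_⟩
  · rw [hlam g z, hr]
  · rw [hlh z]; exact hl z
  · rw [hlh z₀]; exact hl0 z₀

theorem IsCAT0.titsAngle_lt_pi_div_two (hX : IsCAT0 X) {g h : G}
    {e : minSet (fun x : X => h • x) ≃ᵢ WithLp 2 (Z × ℝ)}
    (he : IsMinSplitting (fun x : X => h • x) e) {lam : G →* Multiplicative ℝ}
    (hg : ∀ g z, ∃ z', ∀ t, g • splitLine e z t = splitLine e z' (t + (lam g).toAdd))
    (hh : ∀ z, TranslatesLine (fun x : X => h • x) (splitLine e z) (lam h).toAdd)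
    (hpos : 0 < (lam g).toAdd * (lam h).toAdd) {ξ η : IdealBoundary X}
    (hξ : IsForwardEndpoint (fun x : X => g • x) ξ)
    (hη : IsForwardEndpoint (fun x : X => h • x) η) : titsAngle ξ η < Real.pi / 2 := by
  obtain ⟨cg, l, hcg, hl, rfl⟩ := hξ
  obtain ⟨ch, l', hch, hl', rfl⟩ := hη
  set a := (lam g).toAdd with ha
  set b := (lam h).toAdd with hb
  obtain ⟨z, hz⟩ := (he (range ch)).1 ⟨ch, l', hch, hl'.ne', rfl⟩
  obtain ⟨t₀, ht₀⟩ : ch 0 ∈ range (splitLine e z) := hz ▸ mem_range_self 0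
  have hlb : l' ^ 2 = b ^ 2 := by
    rw [← sq_abs l', ← sq_abs b, hch.abs_eq (hh z)]
  -- This is half the limit `a * b / (l * l')` of the comparison cosines; the slack absorbs the
  -- bounded errors, uniformly in the base point.
  have hκ : 0 < a * b / (2 * l * l') := by positivity
  refine lt_of_le_of_lt (Real.sSup_le ?_ (Real.arccos_nonneg _)) (Real.arccos_lt_pi_div_two.2 hκ)
  rintro _ ⟨c, c', h0, hc, hc', rfl⟩
  obtain ⟨K₁, hK₁⟩ := Quotient.exact hc
  obtain ⟨K₂, hK₂⟩ := Quotient.exact hc'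
  change ∀ t : ℝ≥0, dist (c t) (cg t) ≤ K₁ at hK₁
  change ∀ t : ℝ≥0, dist (c' t) (ch t) ≤ K₂ at hK₂
  set x := ch 0 with hx
  set M := dist x (cg 0) with hM
  have hM0 : 0 ≤ M := dist_nonneg
  have hK₁0 : 0 ≤ K₁ := dist_nonneg.trans (hK₁ 0)
  have hK₂0 : 0 ≤ K₂ := dist_nonneg.trans (hK₂ 0)
  set K := K₁ + M + K₂ with hK
  have hK0 : 0 ≤ K := by positivity
  -- The error terms are a constant plus a multiple of `n`; for such `n > 1` they are at most `n ^ 2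
  -- * (a * b)`.
  obtain ⟨n, hn⟩ := exists_nat_gt
    (max 1 ((K ^ 2 + 4 * K * M + 4 * M ^ 2 + (2 * K * (l + l') + 4 * l * M)) / (a * b)))
  rw [max_lt_iff, div_lt_iff₀ hpos] at hn
  obtain ⟨hn1, hn2⟩ := hn
  have hn0 : (0 : ℝ) < n := one_pos.trans hn1
  have hS : 0 < n * l := mul_pos hn0 hl
  have hT : 0 < n * l' := mul_pos hn0 hl'
  refine (hX.alexandrovAngle_le c c' h0 (S := ⟨n * l, hS.le⟩) (T := ⟨n * l', hT.le⟩) hS hT).trans ?_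
  apply Real.arccos_le_arccos
  have hdS : dist (c 0) (c ⟨n * l, hS.le⟩) = n * l := c.dist_zero_apply _
  have hdT : dist (c 0) (c' ⟨n * l', hT.le⟩) = n * l' := by
    rw [h0]; exact c'.dist_zero_apply _
  rw [hdS, hdT, div_le_div_iff₀ (by positivity) (by positivity)]
  set d := dist (c ⟨n * l, hS.le⟩) (c' ⟨n * l', hT.le⟩) with hd
  set D := dist (g ^ n • x) (h ^ n • x) with hD
  set E := dist (g ^ n • x) x with hE
  have e1 : d ≤ K + D := by
    have f1 := hK₁ ⟨n * l, hS.le⟩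
    have f2 := hK₂ ⟨n * l', hT.le⟩
    change dist _ (cg (n * l)) ≤ _ at f1
    change dist _ (ch (n * l')) ≤ _ at f2
    have f3 := hcg.pow_smul n 0
    have f4 := hch.pow_smul n 0
    rw [zero_add] at f3 f4
    rw [← f3] at f1
    rw [← f4, dist_comm] at f2
    have f5 := dist_triangle4 (c ⟨n * l, hS.le⟩) (g ^ n • cg 0) (g ^ n • x)
      (c' ⟨n * l', hT.le⟩)
    have f6 := dist_triangle (g ^ n • x) (h ^ n • x) (c' ⟨n * l', hT.le⟩)
    rw [dist_smul, dist_comm (cg 0)] at f5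
    linarith
  have e2 : E ≤ n * l + 2 * M := by
    have f1 := dist_triangle4 (g ^ n • x) (g ^ n • cg 0) (cg 0) x
    rw [dist_smul, hcg.pow_smul, hcg.1.dist_eq, Real.dist_eq, zero_add, sub_zero, abs_of_pos hS,
      dist_comm (cg 0)] at f1
    linarith
  have e3 : D ≤ E + n * l' := by
    have f1 := dist_triangle (g ^ n • x) x (h ^ n • x)
    rw [hx, hch.pow_smul, hch.1.dist_eq, Real.dist_eq, zero_add, zero_sub, abs_neg,
      abs_of_pos hT] at f1
    rw [hD, hch.pow_smul, zero_add]
    exact f1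
  -- The heights of `g ^ n • x` and `h ^ n • x` above `x` are `n * a` and `n * b`; the unknown
  -- `Z`-component is common to `D ^ 2` and `E ^ 2`.
  have e4 : D ^ 2 = E ^ 2 - 2 * n ^ 2 * (a * b) + n ^ 2 * l' ^ 2 := by
    obtain ⟨z', hz'⟩ := hg (g ^ n) z
    have f1 := hz' t₀
    rw [map_pow, toAdd_pow, nsmul_eq_mul, ← ha] at f1
    rw [hD, hE, ← ht₀, (hh z).pow_smul, f1, dist_splitLine_sq, dist_splitLine_sq, hlb]
    ring
  have hd0 : 0 ≤ d := dist_nonneg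
  have hD0 : 0 ≤ D := dist_nonneg
  have hE0 : 0 ≤ E := dist_nonneg
  have e5 : d ^ 2 ≤ (K + D) ^ 2 := pow_le_pow_left₀ hd0 e1 2
  have e6 : E ^ 2 ≤ (n * l + 2 * M) ^ 2 := pow_le_pow_left₀ hE0 e2 2
  have e7 : K * D ≤ K * (n * l + 2 * M + n * l') :=
    mul_le_mul_of_nonneg_left (e3.trans (by linarith)) hK0
  have e8 : K ^ 2 + 4 * K * M + 4 * M ^ 2 + n * (2 * K * (l + l') + 4 * l * M) ≤
      n ^ 2 * (a * b) := by
    have g1 : 0 ≤ K ^ 2 + 4 * K * M + 4 * M ^ 2 := by positivity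
    nlinarith [mul_le_mul_of_nonneg_left hn2.le hn0.le, mul_nonneg g1 (sub_nonneg.2 hn1.le)]
  have e9 : n ^ 2 * (a * b) ≤ (n * l) ^ 2 + (n * l') ^ 2 - d ^ 2 := by linarith
  calc a * b * (2 * (n * l) * (n * l')) = n ^ 2 * (a * b) * (2 * l * l') := by ring
    _ ≤ _ := mul_le_mul_of_nonneg_right e9 (by positivity)

end Splitting

/-! ### Torus knot groups -/

namespace TorusKnotGroup

theorem commute_tau (p q : ℕ) (g : TorusKnotGroup p q) : g * tau p q = tau p q * g := by
  have hle : Subgroup.closure (range (PresentedGroup.of : Fin 2 → TorusKnotGroup p q)) ≤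
      Subgroup.centralizer {tau p q} := by
    rw [Subgroup.closure_le]
    rintro _ ⟨i, rfl⟩
    rw [SetLike.mem_coe, Subgroup.mem_centralizer_singleton_iff]
    fin_cases i
    · exact (Commute.refl (a p q)).pow_right p
    · rw [tau_eq]
      exact (Commute.refl (b p q)).pow_right q
  rw [PresentedGroup.closure_range_of] at hle
  exact Subgroup.mem_centralizer_singleton_iff.1 (hle (Subgroup.mem_top g))

/-- The homomorphism to `ℤ` sending `a` to `q` and `b` to `p`. -/
def toInt (p q : ℕ) : TorusKnotGroup p q →* Multiplicative ℤ :=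
  PresentedGroup.toGroup (f := ![Multiplicative.ofAdd (q : ℤ), Multiplicative.ofAdd (p : ℤ)])
    (by
      intro r hr
      rw [mem_singleton_iff.1 hr, map_mul, map_inv, map_pow, map_pow, FreeGroup.lift_apply_of,
        FreeGroup.lift_apply_of, mul_inv_eq_one]
      exact Multiplicative.toAdd.injective (by simp [mul_comm]))

theorem toInt_a (p q : ℕ) : toInt p q (a p q) = Multiplicative.ofAdd (q : ℤ) :=
  PresentedGroup.toGroup.of _

theorem toInt_b (p q : ℕ) : toInt p q (b p q) = Multiplicative.ofAdd (p : ℤ) :=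
  PresentedGroup.toGroup.of _

theorem injective_pow_of_toInt_ne {p q : ℕ} {g : TorusKnotGroup p q}
    (hg : (toInt p q g).toAdd ≠ 0) : Function.Injective fun n : ℕ => g ^ n := fun i j hij => by
  have h := congrArg (fun x => (toInt p q x).toAdd) hij
  simpa [hg] using h

theorem toInt_tau (p q : ℕ) : (toInt p q (tau p q)).toAdd = p * q := by
  rw [tau, map_pow, toInt_a]
  simp

theorem toInt_omega (p q : ℕ) (m n : ℤ) : (toInt p q (omega p q m n)).toAdd = m * q + n * p := by
  rw [omega, map_mul, map_zpow, map_zpow, toInt_a, toInt_b]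
  simp [add_comm]

theorem hom_omega {p q : ℕ} (hp : 0 < p) (hq : 0 < q) {m n : ℤ} (hmn : m * q + n * p = 1)
    (lam : TorusKnotGroup p q →* Multiplicative ℝ) :
    (lam (omega p q m n)).toAdd = (lam (tau p q)).toAdd / (p * q) := by
  have hp' : (p : ℝ) ≠ 0 := by positivity
  have hq' : (q : ℝ) ≠ 0 := by positivity
  have h1 : (lam (tau p q)).toAdd = p * (lam (a p q)).toAdd := by
    rw [tau, map_pow, toAdd_pow, nsmul_eq_mul]
  have h2 : (lam (tau p q)).toAdd = q * (lam (b p q)).toAdd := by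
    rw [tau_eq, map_pow, toAdd_pow, nsmul_eq_mul]
  have h3 : (lam (omega p q m n)).toAdd = n * (lam (b p q)).toAdd + m * (lam (a p q)).toAdd := by
    rw [omega, map_mul, map_zpow, map_zpow, toAdd_mul, toAdd_zpow, toAdd_zpow, zsmul_eq_mul,
      zsmul_eq_mul]
  have h4 : (m : ℝ) * q + n * p = 1 := by exact_mod_cast hmn
  rw [eq_div_iff (mul_ne_zero hp' hq'), h3]
  linear_combination (lam (tau p q)).toAdd * h4 - n * p * h2 - m * q * h1

end TorusKnotGroup

theorem mainTheorem9 (p q : ℕ) (hp : 0 < p) (hq : 0 < q) (hpq : Nat.Coprime p q)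
    (m n : ℤ) (hmn : m * q + n * p = 1)
    {X : Type u} [MetricSpace X] [Nonempty X] [MulAction (TorusKnotGroup p q) X]
    (hX : IsCAT0 X) (hG : IsGeometricAction (TorusKnotGroup p q) X) :
    (∃! ξ : IdealBoundary X,
      IsForwardEndpoint (fun x => TorusKnotGroup.omega p q m n • x) ξ) ∧
    (∃! η : IdealBoundary X,
      IsForwardEndpoint (fun x => TorusKnotGroup.tau p q • x) η) ∧
    (∀ ξ η : IdealBoundary X,
      IsForwardEndpoint (fun x => TorusKnotGroup.omega p q m n • x) ξ →
      IsForwardEndpoint (fun x => TorusKnotGroup.tau p q • x) η →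
      titsAngle ξ η ≠ Real.pi / 2) ∧
    (∃ (Z : Type u) (_ : MetricSpace Z)
      (e : minSet (fun x : X => TorusKnotGroup.tau p q • x) ≃ᵢ WithLp 2 (Z × ℝ)),
      IsMinSplitting (fun x : X => TorusKnotGroup.tau p q • x) e) ∧
    (∀ (Z : Type v) [MetricSpace Z]
      (e : minSet (fun x : X => TorusKnotGroup.tau p q • x) ≃ᵢ WithLp 2 (Z × ℝ)),
      IsMinSplitting (fun x : X => TorusKnotGroup.tau p q • x) e →
      ∃ lam : TorusKnotGroup p q → ℝ,
        (∀ (g : TorusKnotGroup p q) (x : minSet (fun x : X => TorusKnotGroup.tau p q • x)),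
          ∃ hgx : g • (x : X) ∈ minSet (fun x : X => TorusKnotGroup.tau p q • x),
            (e ⟨g • (x : X), hgx⟩).snd = (e x).snd + lam g) ∧
        lam (TorusKnotGroup.omega p q m n) = lam (TorusKnotGroup.tau p q) / (p * q) ∧
        lam (TorusKnotGroup.omega p q m n) ≠ 0) := by
  have := hG.isometric
  have hp' : (0 : ℝ) < p := by exact_mod_cast hp
  have hq' : (0 : ℝ) < q := by exact_mod_cast hq
  have hω : Function.Injective fun k : ℕ => TorusKnotGroup.omega p q m n ^ k :=
    TorusKnotGroup.injective_pow_of_toInt_ne (by rw [TorusKnotGroup.toInt_omega, hmn]; simp)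
  have hτ : Function.Injective fun k : ℕ => TorusKnotGroup.tau p q ^ k :=
    TorusKnotGroup.injective_pow_of_toInt_ne (by rw [TorusKnotGroup.toInt_tau]; positivity)
  have hcomm := TorusKnotGroup.commute_tau p q
  obtain ⟨x₀, hx₀⟩ := hG.nonempty_minSet hX (TorusKnotGroup.tau p q)
  have hsplit := hX.exists_isMinSplitting ⟨x₀, hx₀⟩ (hG.smul_ne hτ)
  refine ⟨existsUnique_isForwardEndpoint hX hG hω, existsUnique_isForwardEndpoint hX hG hτ,
    fun ξ η hξ hη => ?_, hsplit, fun Z _ e he => ?_⟩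
  · obtain ⟨Z, _, e, he⟩ := hsplit
    obtain ⟨lam, hg, hh, hne⟩ := he.exists_hom hcomm (e ⟨x₀, hx₀⟩).fst
    refine (hX.titsAngle_lt_pi_div_two he hg hh ?_ hξ hη).ne
    rw [TorusKnotGroup.hom_omega hp hq hmn, div_mul_eq_mul_div]
    exact div_pos (mul_self_pos.2 hne) (mul_pos hp' hq')
  · obtain ⟨lam, hg, -, hne⟩ := he.exists_hom hcomm (e ⟨x₀, hx₀⟩).fst
    refine ⟨fun g => (lam g).toAdd, fun g x => ?_, TorusKnotGroup.hom_omega hp hq hmn lam, ?_⟩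
    · obtain ⟨z', hz'⟩ := hg g (e x).fst
      have h1 := hz' (e x).snd
      rw [splitLine_apply] at h1
      exact ⟨h1 ▸ splitLine_mem e _ _, apply_splitLine_snd e h1 _⟩
    · exact (TorusKnotGroup.hom_omega hp hq hmn lam).trans_ne <| div_ne_zero hne (mul_pos hp' hq').ne'
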